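/- **Suspension calculus.** Fix a set of constants. Pre-terms and pre-environments (no meta variables) are $$t ::= c \mid \#i \mid (t\;t) \mid (\lambda\,t) \mid [t,ol,nl,e],\qquad e ::= nil \mid (t,l)::e \mid \{e,nl,ol,e\},$$ with $c$ a constant, $i\ge 1$ and $l,ol,nl\in\mathbb N$. Write $m\dot-n=\max(m-n,0)$. Put $len(nil)=0$, $len((t,n)::e)=1+len(e)$, $len(\{e_1,nl_1,ol_2,e_2\})=len(e_1)+(ol_2\dot- nl_1)$; and $lev(nil)=0$, $lev((t,n)::e)=n$, $lev(\{e_1,nl_1,ol_2,e_2\})=lev(e_2)+(nl_1\dot- ol_2)$. An expression is well formed if every subexpression $[t,ol,nl,e]$ has $len(e)=ol$ and $lev(e)\le nl$, every $\{e_1,nl_1,ol_2,e_2\}$ has $len(e_2)=ol_2$ and $lev(e_1)\le nl_1$, and every $(t,n)::e$ has $lev(e)\le n$; well-formed pre-terms and pre-environments are called suspension terms and environments. The relation $\rhd_{rm}$ is one application, at any subexpression, of a reading rule - $[c,ol,nl,e]\to c$; - $[\#i,0,nl,nil]\to\#(i+nl)$; - $[\#1,ol,nl,(t,l)::e]\to[t,0,nl-l,nil]$;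 - $[\#i,ol,nl,(t,l)::e]\to[\#(i-1),ol-1,nl,e]$ if $i>1$; - $[(t_1\,t_2),ol,nl,e]\to([t_1,ol,nl,e]\;[t_2,ol,nl,e])$; - $[\lambda t,ol,nl,e]\to\lambda[t,ol+1,nl+1,(\#1,nl+1)::e]$; or a merging rule - $[[t,ol_1,nl_1,e_1],ol_2,nl_2,e_2]\to[t,ol_1+(ol_2\dot- nl_1),nl_2+(nl_1\dot- ol_2),\{e_1,nl_1,ol_2,e_2\}]$; - $\{e_1,nl_1,0,nil\}\to e_1$; $\ \{nil,0,ol_2,e_2\}\to e_2$; - $\{nil,nl_1,ol_2,(t,l)::e_2\}\to\{nil,nl_1-1,ol_2-1,e_2\}$ if $nl_1\ge1$; - $\{(t,n)::e_1,nl_1,ol_2,(s,l)::e_2\}\to\{(t,n)::e_1,nl_1-1,ol_2-1,e_2\}$ if $nl_1>n$; - $\{(t,n)::e_1,n,ol_2,(s,l)::e_2\}\to([t,ol_2,l,(s,l)::e_2],\,l+(n\dot- ol_2))::\{e_1,n,ol_2,(s,l)::e_2\}$. Its reflexive transitive closure is $\rhd_{rm}^*$. Similarity $\sim$ on suspension expressions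 is the smallest reflexive relation compatible with every constructor (all numbers being unchanged) such that $([t,ol,nl,r],nl+k)::e\sim([t',ol,nl',r'],nl'+k)::e'$ whenever $t\sim t'$, $r\sim r'$, $e\sim e'$. **$\lambda\sigma$-calculus.** Terms $a::=1\mid ab\mid\lambda a\mid a[s]$ and substitutions $s::=id\mid{\uparrow}\mid a\cdot s\mid s\circ t$. The relation $\to_\sigma$ is one application, at any subexpression, of one of the rules (App) $(ab)[s]\to a[s]\,b[s]$; (Abs) $(\lambda a)[s]\to\lambda a[1\cdot(s\circ{\uparrow})]$; (Clos) $a[s][t]\to a[s\circ t]$; (VarId) $1[id]\to1$; (VarCons) $1[a\cdot s]\to a$; (Map) $(a\cdot s)\circ t\to a[t]\cdot(s\circ t)$; (Ass) $(s\circ t)\circ u\to s\circ(t\circ u)$; (IdL) $id\circ s\to s$; (ShiftId) ${\uparrow}\circ id\to{\uparrow}$; (ShiftCons) ${\uparrow}\circ(a\cdot s)\to s$. **Translation.** Let ${\uparrow}^1={\uparrow}$ and ${\uparrow}^{n+1}={\uparrow}^n\circ{\uparrow}$. Define $T$ on $\lambda\sigma$-terms and $E$ on $\lambda\sigma$-substitutions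 simultaneously, the first applicable clause being used: $T(1)=\#1$; $T(1[{\uparrow}^n])=\#(n+1)$ for $n\ge1$; $T(ab)=(T(a)\;T(b))$; $T(\lambda a)=\lambda\,T(a)$; $T(a[s])=[T(a),ol,nl,e]$ where $(ol,nl,e)=E(s)$; $E(id)=(0,0,nil)$; $E({\uparrow})=(0,1,nil)$; $E(a\cdot s)=(ol+1,nl,(T(a),nl)::e)$ and $E(s\circ{\uparrow})=(ol,nl+1,e)$ where $(ol,nl,e)=E(s)$; $E(s_1\circ s_2)=(ol_1+(ol_2\dot- nl_1),\,nl_2+(nl_1\dot- ol_2),\,\{e_1,nl_1,ol_2,e_2\})$ where $(ol_i,nl_i,e_i)=E(s_i)$. **Theorem.** 1. If $a,b$ are $\lambda\sigma$-terms with $a\to_\sigma b$, then there is a suspension term $t$ such that $T(a)\rhd_{rm}^*t$ and $T(b)\rhd_{rm}^*t$. 2. If $s,s'$ are $\lambda\sigma$-substitutions with $s\to_\sigma s'$, and $E(s)=(ol,nl,e)$, $E(s')=(ol',nl',e')$, then $ol=ol'$, $nl=nl'$, and $e$ and $e'$ are similar up to $\rhd_{rm}$-convertibility: there are suspension environments $d\sim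 d'$ such that $e$ and $d$ have a common $\rhd_{rm}^*$-reduct, and $e'$ and $d'$ have a common $\rhd_{rm}^*$-reduct. -/

import Mathlib

universe u

/-! Suspension calculus: syntax -/

mutual
/-- Pre-terms of the suspension calculus over a set `C` of constants (no meta variables).
`susp t ol nl e` is the suspension `[t, ol, nl, e]`; `idx i` is the index `#i`, counted from 1. -/
inductive STerm (C : Type u) where
  | const (c : C) : STerm C
  | idx (i : ℕ) : STerm C
  | app (t₁ t₂ : STerm C) : STerm C
  | lam (t : STerm C) : STerm C
  | susp (t : STerm C) (ol nl : ℕ) (e : SEnv C) : STerm C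

/-- Pre-environments of the suspension calculus. `cons t l e` is `(t, l) :: e` and
`merge e₁ nl₁ ol₂ e₂` is the merged environment `{e₁, nl₁, ol₂, e₂}`. -/
inductive SEnv (C : Type u) where
  | nil : SEnv C
  | cons (t : STerm C) (l : ℕ) (e : SEnv C) : SEnv C
  | merge (e₁ : SEnv C) (nl₁ ol₂ : ℕ) (e₂ : SEnv C) : SEnv C
end

/-- The length of an environment (subtraction on `ℕ` is truncated, as intended). -/
def SEnv.len {C : Type u} : SEnv C → ℕ
  | .nil => 0
  | .cons _ _ e => 1 + e.len
  | .merge e₁ nl₁ ol₂ _ => e₁.len + (ol₂ - nl₁)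

/-- The level of an environment (subtraction on `ℕ` is truncated, as intended). -/
def SEnv.lev {C : Type u} : SEnv C → ℕ
  | .nil => 0
  | .cons _ n _ => n
  | .merge _ nl₁ ol₂ e₂ => e₂.lev + (nl₁ - ol₂)

mutual
/-- Well-formedness: the suspension terms are the pre-terms with this property. -/
def STerm.WF {C : Type u} : STerm C → Prop
  | .const _ => True
  | .idx i => 1 ≤ i
  | .app t₁ t₂ => t₁.WF ∧ t₂.WF
  | .lam t => t.WF
  | .susp t ol nl e => t.WF ∧ e.WF ∧ e.len = ol ∧ e.lev ≤ nl

/-- Well-formedness of environments. -/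
def SEnv.WF {C : Type u} : SEnv C → Prop
  | .nil => True
  | .cons t n e => t.WF ∧ e.WF ∧ e.lev ≤ n
  | .merge e₁ nl₁ ol₂ e₂ => e₁.WF ∧ e₂.WF ∧ e₂.len = ol₂ ∧ e₁.lev ≤ nl₁
end

/-! Suspension calculus: reading and merging rules -/

/-- The reading rules (r1)-(r6), at the root. -/
inductive STerm.ReadRule {C : Type u} : STerm C → STerm C → Prop
  | r1 (c : C) (ol nl : ℕ) (e : SEnv C) :
      ReadRule (.susp (.const c) ol nl e) (.const c)
  | r2 (i nl : ℕ) :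
      ReadRule (.susp (.idx i) 0 nl .nil) (.idx (i + nl))
  | r3 (ol nl : ℕ) (t : STerm C) (l : ℕ) (e : SEnv C) :
      ReadRule (.susp (.idx 1) ol nl (.cons t l e)) (.susp t 0 (nl - l) .nil)
  | r4 (i ol nl : ℕ) (t : STerm C) (l : ℕ) (e : SEnv C) (hi : 1 < i) :
      ReadRule (.susp (.idx i) ol nl (.cons t l e)) (.susp (.idx (i - 1)) (ol - 1) nl e)
  | r5 (t₁ t₂ : STerm C) (ol nl : ℕ) (e : SEnv C) :
      ReadRule (.susp (.app t₁ t₂) ol nl e) (.app (.susp t₁ ol nl e) (.susp t₂ ol nl e))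
  | r6 (t : STerm C) (ol nl : ℕ) (e : SEnv C) :
      ReadRule (.susp (.lam t) ol nl e)
        (.lam (.susp t (ol + 1) (nl + 1) (.cons (.idx 1) (nl + 1) e)))

/-- The merging rule (m1), the only one on terms, at the root. -/
inductive STerm.MergeRule {C : Type u} : STerm C → STerm C → Prop
  | m1 (t : STerm C) (ol₁ nl₁ : ℕ) (e₁ : SEnv C) (ol₂ nl₂ : ℕ) (e₂ : SEnv C) :
      MergeRule (.susp (.susp t ol₁ nl₁ e₁) ol₂ nl₂ e₂)
        (.susp t (ol₁ + (ol₂ - nl₁)) (nl₂ + (nl₁ - ol₂)) (.merge e₁ nl₁ ol₂ e₂))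

/-- The merging rules (m2)-(m6) on environments, at the root. -/
inductive SEnv.MergeRule {C : Type u} : SEnv C → SEnv C → Prop
  | m2 (e₁ : SEnv C) (nl₁ : ℕ) :
      MergeRule (.merge e₁ nl₁ 0 .nil) e₁
  | m3 (ol₂ : ℕ) (e₂ : SEnv C) :
      MergeRule (.merge .nil 0 ol₂ e₂) e₂
  | m4 (nl₁ ol₂ : ℕ) (t : STerm C) (l : ℕ) (e₂ : SEnv C) (h : 1 ≤ nl₁) :
      MergeRule (.merge .nil nl₁ ol₂ (.cons t l e₂)) (.merge .nil (nl₁ - 1) (ol₂ - 1) e₂)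
  | m5 (t : STerm C) (n : ℕ) (e₁ : SEnv C) (nl₁ ol₂ : ℕ) (s : STerm C) (l : ℕ) (e₂ : SEnv C)
      (h : n < nl₁) :
      MergeRule (.merge (.cons t n e₁) nl₁ ol₂ (.cons s l e₂))
        (.merge (.cons t n e₁) (nl₁ - 1) (ol₂ - 1) e₂)
  | m6 (t : STerm C) (n : ℕ) (e₁ : SEnv C) (ol₂ : ℕ) (s : STerm C) (l : ℕ) (e₂ : SEnv C) :
      MergeRule (.merge (.cons t n e₁) n ol₂ (.cons s l e₂))
        (.cons (.susp t ol₂ l (.cons s l e₂)) (l + (n - ol₂))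
          (.merge e₁ n ol₂ (.cons s l e₂)))

mutual
/-- One step by a reading or merging rule, applied at any subexpression of a term. -/
inductive STerm.RMStep {C : Type u} : STerm C → STerm C → Prop
  | read {t t' : STerm C} (h : t.ReadRule t') : STerm.RMStep t t'
  | merge {t t' : STerm C} (h : t.MergeRule t') : STerm.RMStep t t'
  | app_left {t₁ t₁' : STerm C} (t₂ : STerm C) (h : STerm.RMStep t₁ t₁') :
      STerm.RMStep (.app t₁ t₂) (.app t₁' t₂)
  | app_right (t₁ : STerm C) {t₂ t₂' : STerm C} (h : STerm.RMStep t₂ t₂') :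
      STerm.RMStep (.app t₁ t₂) (.app t₁ t₂')
  | lam {t t' : STerm C} (h : STerm.RMStep t t') : STerm.RMStep (.lam t) (.lam t')
  | susp_term {t t' : STerm C} (ol nl : ℕ) (e : SEnv C) (h : STerm.RMStep t t') :
      STerm.RMStep (.susp t ol nl e) (.susp t' ol nl e)
  | susp_env (t : STerm C) (ol nl : ℕ) {e e' : SEnv C} (h : SEnv.RMStep e e') :
      STerm.RMStep (.susp t ol nl e) (.susp t ol nl e')

/-- One step by a reading or merging rule, applied at any subexpression of an environment. -/
inductive SEnv.RMStep {C : Type u} : SEnv C → SEnv C → Prop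
  | merge {e e' : SEnv C} (h : e.MergeRule e') : SEnv.RMStep e e'
  | cons_head {t t' : STerm C} (l : ℕ) (e : SEnv C) (h : STerm.RMStep t t') :
      SEnv.RMStep (.cons t l e) (.cons t' l e)
  | cons_tail (t : STerm C) (l : ℕ) {e e' : SEnv C} (h : SEnv.RMStep e e') :
      SEnv.RMStep (.cons t l e) (.cons t l e')
  | merge_left {e₁ e₁' : SEnv C} (nl₁ ol₂ : ℕ) (e₂ : SEnv C) (h : SEnv.RMStep e₁ e₁') :
      SEnv.RMStep (.merge e₁ nl₁ ol₂ e₂) (.merge e₁' nl₁ ol₂ e₂)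
  | merge_right (e₁ : SEnv C) (nl₁ ol₂ : ℕ) {e₂ e₂' : SEnv C} (h : SEnv.RMStep e₂ e₂') :
      SEnv.RMStep (.merge e₁ nl₁ ol₂ e₂) (.merge e₁ nl₁ ol₂ e₂')
end

/-- Reflexive and transitive closure of `STerm.RMStep`. -/
def STerm.RMSteps {C : Type u} : STerm C → STerm C → Prop := Relation.ReflTransGen STerm.RMStep

/-- Reflexive and transitive closure of `SEnv.RMStep`. -/
def SEnv.RMSteps {C : Type u} : SEnv C → SEnv C → Prop := Relation.ReflTransGen SEnv.RMStep

/-! Similarity -/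

mutual
/-- Similarity of terms. -/
inductive STerm.Sim {C : Type u} : STerm C → STerm C → Prop
  | refl (t : STerm C) : STerm.Sim t t
  | app {t₁ t₁' t₂ t₂' : STerm C} (h₁ : STerm.Sim t₁ t₁') (h₂ : STerm.Sim t₂ t₂') :
      STerm.Sim (.app t₁ t₂) (.app t₁' t₂')
  | lam {t t' : STerm C} (h : STerm.Sim t t') : STerm.Sim (.lam t) (.lam t')
  | susp {t t' : STerm C} {e e' : SEnv C} (ol nl : ℕ)
      (ht : STerm.Sim t t') (he : SEnv.Sim e e') :
      STerm.Sim (.susp t ol nl e) (.susp t' ol nl e')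

/-- Similarity of environments. An environment term `(t, n)` occurs only as the head of a `cons`,
so similarity of environment terms is part of the rule `cons`. The rule `renumber` trades
explicit renumbering inside a head term for its index. -/
inductive SEnv.Sim {C : Type u} : SEnv C → SEnv C → Prop
  | refl (e : SEnv C) : SEnv.Sim e e
  | cons {t t' : STerm C} {e e' : SEnv C} (n : ℕ)
      (ht : STerm.Sim t t') (he : SEnv.Sim e e') :
      SEnv.Sim (.cons t n e) (.cons t' n e')
  | merge {e₁ e₁' e₂ e₂' : SEnv C} (nl₁ ol₂ : ℕ)
      (h₁ : SEnv.Sim e₁ e₁') (h₂ : SEnv.Sim e₂ e₂') :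
      SEnv.Sim (.merge e₁ nl₁ ol₂ e₂) (.merge e₁' nl₁ ol₂ e₂')
  | renumber {t t' : STerm C} {r r' e e' : SEnv C} (ol nl nl' k : ℕ)
      (ht : STerm.Sim t t') (hr : SEnv.Sim r r') (he : SEnv.Sim e e') :
      SEnv.Sim (.cons (.susp t ol nl r) (nl + k) e) (.cons (.susp t' ol nl' r') (nl' + k) e')
end

/-! The λσ-calculus -/

mutual
/-- Terms of the λσ-calculus; `clos a s` is the closure `a[s]`. -/
inductive LSTerm where
  | one : LSTerm
  | app (a b : LSTerm) : LSTerm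
  | lam (a : LSTerm) : LSTerm
  | clos (a : LSTerm) (s : LSSub) : LSTerm

/-- Substitutions of the λσ-calculus; `cons a s` is `a · s` and `comp s t` is `s ∘ t`. -/
inductive LSSub where
  | id : LSSub
  | shift : LSSub
  | cons (a : LSTerm) (s : LSSub) : LSSub
  | comp (s t : LSSub) : LSSub
end

/-- The σ-rules on terms (all rules on terms except (Beta)), at the root. -/
inductive LSTerm.SigmaRule : LSTerm → LSTerm → Prop
  | app (a b : LSTerm) (s : LSSub) :
      SigmaRule (.clos (.app a b) s) (.app (.clos a s) (.clos b s))
  | abs (a : LSTerm) (s : LSSub) :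
      SigmaRule (.clos (.lam a) s) (.lam (.clos a (.cons .one (.comp s .shift))))
  | clos (a : LSTerm) (s t : LSSub) :
      SigmaRule (.clos (.clos a s) t) (.clos a (.comp s t))
  | varId : SigmaRule (.clos .one .id) .one
  | varCons (a : LSTerm) (s : LSSub) : SigmaRule (.clos .one (.cons a s)) a

/-- The σ-rules on substitutions, at the root. -/
inductive LSSub.SigmaRule : LSSub → LSSub → Prop
  | map (a : LSTerm) (s t : LSSub) :
      SigmaRule (.comp (.cons a s) t) (.cons (.clos a t) (.comp s t))
  | ass (s t u : LSSub) : SigmaRule (.comp (.comp s t) u) (.comp s (.comp t u))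
  | idL (s : LSSub) : SigmaRule (.comp .id s) s
  | shiftId : SigmaRule (.comp .shift .id) .shift
  | shiftCons (a : LSTerm) (s : LSSub) : SigmaRule (.comp .shift (.cons a s)) s

mutual
/-- One σ-step, at any subexpression of a term. -/
inductive LSTerm.SigmaStep : LSTerm → LSTerm → Prop
  | rule {a a' : LSTerm} (h : a.SigmaRule a') : LSTerm.SigmaStep a a'
  | app_left {a a' : LSTerm} (b : LSTerm) (h : LSTerm.SigmaStep a a') :
      LSTerm.SigmaStep (.app a b) (.app a' b)
  | app_right (a : LSTerm) {b b' : LSTerm} (h : LSTerm.SigmaStep b b') :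
      LSTerm.SigmaStep (.app a b) (.app a b')
  | lam {a a' : LSTerm} (h : LSTerm.SigmaStep a a') : LSTerm.SigmaStep (.lam a) (.lam a')
  | clos_term {a a' : LSTerm} (s : LSSub) (h : LSTerm.SigmaStep a a') :
      LSTerm.SigmaStep (.clos a s) (.clos a' s)
  | clos_sub (a : LSTerm) {s s' : LSSub} (h : LSSub.SigmaStep s s') :
      LSTerm.SigmaStep (.clos a s) (.clos a s')

/-- One σ-step, at any subexpression of a substitution. -/
inductive LSSub.SigmaStep : LSSub → LSSub → Prop
  | rule {s s' : LSSub} (h : s.SigmaRule s') : LSSub.SigmaStep s s'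
  | cons_head {a a' : LSTerm} (s : LSSub) (h : LSTerm.SigmaStep a a') :
      LSSub.SigmaStep (.cons a s) (.cons a' s)
  | cons_tail (a : LSTerm) {s s' : LSSub} (h : LSSub.SigmaStep s s') :
      LSSub.SigmaStep (.cons a s) (.cons a s')
  | comp_left {s s' : LSSub} (t : LSSub) (h : LSSub.SigmaStep s s') :
      LSSub.SigmaStep (.comp s t) (.comp s' t)
  | comp_right (s : LSSub) {t t' : LSSub} (h : LSSub.SigmaStep t t') :
      LSSub.SigmaStep (.comp s t) (.comp s t')
end

/-! The translation from λσ-expressions to suspension expressions -/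

/-- `s.shiftExp? = some n` exactly when `n ≥ 1` and `s` is
`↑ⁿ = (… (↑ ∘ ↑) ∘ …) ∘ ↑` with `n` shifts, associated to the left. -/
def LSSub.shiftExp? : LSSub → Option ℕ
  | .shift => some 1
  | .comp s .shift => s.shiftExp?.map (· + 1)
  | _ => none

mutual
/-- The translation `T`. The special case `T(1[↑ⁿ]) = #(n+1)` takes precedence. -/
def LSTerm.toSusp (C : Type u) : LSTerm → STerm C
  | .one => .idx 1
  | .app a b => .app (a.toSusp C) (b.toSusp C)
  | .lam a => .lam (a.toSusp C)
  | .clos .one s =>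
      match s.shiftExp? with
      | some n => .idx (n + 1)
      | none => .susp (.idx 1) (s.toEnv C).1 (s.toEnv C).2.1 (s.toEnv C).2.2
  | .clos a s => .susp (a.toSusp C) (s.toEnv C).1 (s.toEnv C).2.1 (s.toEnv C).2.2

/-- The translation `E`, with values `(ol, nl, e)`. The special case `s ∘ ↑` takes precedence. -/
def LSSub.toEnv (C : Type u) : LSSub → ℕ × ℕ × SEnv C
  | .id => (0, 0, .nil)
  | .shift => (0, 1, .nil)
  | .cons a s =>
      ((s.toEnv C).1 + 1, (s.toEnv C).2.1, .cons (a.toSusp C) (s.toEnv C).2.1 (s.toEnv C).2.2)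
  | .comp s .shift => ((s.toEnv C).1, (s.toEnv C).2.1 + 1, (s.toEnv C).2.2)
  | .comp s t =>
      ((s.toEnv C).1 + ((t.toEnv C).1 - (s.toEnv C).2.1),
        (t.toEnv C).2.1 + ((s.toEnv C).2.1 - (t.toEnv C).1),
        .merge (s.toEnv C).2.2 (s.toEnv C).2.1 (t.toEnv C).1 (t.toEnv C).2.2)
end

-- Both calculi are interpreted in pure de Bruijn terms with simultaneous substitution. Every σ-rule
-- is an identity of this model, so a σ-step preserves denotations. Conversely, reading and merging
-- compute the denotation: `T(a)` reduces to the pure term denoted by `a` (`LSTerm.toSusp_rmSteps`),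
-- which is therefore the common reduct in the first part. No confluence or termination is needed.
--
-- For substitutions, `E(s)` reduces to a list of pure terms with decreasing levels that denotes the
-- same function as `s` (`LSSub.toEnv_rmSteps`, resting on `DBEnv.exists_merge_rmSteps`). Such a
-- list is not unique: an entry `(u, n)` read at level `nl` contributes `u` shifted by `nl - n`, so
-- part of the shift may sit in the term or in the level. For (Map) the two sides can indeed end
-- with different levels. As shifting is injective, this is the only freedom, and the `renumber`
-- clause of similarity absorbs it (`DBEnv.exists_sim`).

/-! Pure de Bruijn terms -/

/-- De Bruijn terms without constants, with indices counted from 0. -/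
inductive DBTerm where
  | var (i : ℕ) : DBTerm
  | app (t₁ t₂ : DBTerm) : DBTerm
  | lam (t : DBTerm) : DBTerm

namespace DBTerm

/-- The action of a renaming under a binder. -/
def liftRen (f : ℕ → ℕ) : ℕ → ℕ
  | 0 => 0
  | i + 1 => f i + 1

/-- Renaming of the free indices. -/
def rename : (ℕ → ℕ) → DBTerm → DBTerm
  | f, var i => var (f i)
  | f, app t₁ t₂ => app (t₁.rename f) (t₂.rename f)
  | f, lam t => lam (t.rename (liftRen f))

/-- The action of a substitution under a binder. -/
def up (σ : ℕ → DBTerm) : ℕ → DBTerm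
  | 0 => var 0
  | i + 1 => (σ i).rename (· + 1)

/-- Simultaneous capture-avoiding substitution. -/
def subst : (ℕ → DBTerm) → DBTerm → DBTerm
  | σ, var i => σ i
  | σ, app t₁ t₂ => app (t₁.subst σ) (t₂.subst σ)
  | σ, lam t => lam (t.subst (up σ))

/-- Adding `n` to all free indices. -/
abbrev shift (n : ℕ) (t : DBTerm) : DBTerm := t.rename (· + n)

-- Composition laws for renaming and substitution.

theorem rename_rename (t : DBTerm) (f g : ℕ → ℕ) :
    (t.rename f).rename g = t.rename (g ∘ f) := by
  induction t generalizing f g with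
  | var i => rfl
  | app t₁ t₂ h₁ h₂ => simp only [rename, h₁, h₂]
  | lam t h =>
    simp only [rename, h]
    congr 2
    funext i
    cases i <;> rfl

theorem subst_rename (t : DBTerm) (f : ℕ → ℕ) (σ : ℕ → DBTerm) :
    (t.rename f).subst σ = t.subst (σ ∘ f) := by
  induction t generalizing f σ with
  | var i => rfl
  | app t₁ t₂ h₁ h₂ => simp only [rename, subst, h₁, h₂]
  | lam t h =>
    simp only [rename, subst, h]
    congr 2
    funext i
    cases i <;> rfl

theorem rename_subst (t : DBTerm) (σ : ℕ → DBTerm) (f : ℕ → ℕ) :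
    (t.subst σ).rename f = t.subst (fun i => (σ i).rename f) := by
  induction t generalizing f σ with
  | var i => rfl
  | app t₁ t₂ h₁ h₂ => simp only [rename, subst, h₁, h₂]
  | lam t h =>
    simp only [rename, subst, h]
    congr 2
    funext i
    cases i with
    | zero => rfl
    | succ i => simp only [up, rename_rename]; rfl

/-- Since `up` renames, the binder case needs both mixed laws `subst_rename` and `rename_subst`. -/
theorem subst_subst (t : DBTerm) (σ τ : ℕ → DBTerm) :
    (t.subst σ).subst τ = t.subst (fun i => (σ i).subst τ) := by
  induction t generalizing σ τ with
  | var i => rfl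
  | app t₁ t₂ h₁ h₂ => simp only [subst, h₁, h₂]
  | lam t h =>
    simp only [subst, h]
    congr 2
    funext i
    cases i with
    | zero => rfl
    | succ i => simp only [up, subst_rename, rename_subst]; rfl

theorem up_var : up var = var := by
  funext i
  cases i <;> rfl

theorem subst_var (t : DBTerm) : t.subst var = t := by
  induction t with
  | var i => rfl
  | app t₁ t₂ h₁ h₂ => simp only [subst, h₁, h₂]
  | lam t h => simp only [subst, up_var, h]

theorem rename_eq_subst (t : DBTerm) (f : ℕ → ℕ) : t.rename f = t.subst (fun i => var (f i)) := by
  rw [← subst_var (t.rename f), subst_rename]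
  rfl

theorem liftRen_injective {f : ℕ → ℕ} (hf : f.Injective) : (liftRen f).Injective := by
  intro i j h
  cases i <;> cases j <;> simp_all [liftRen, hf.eq_iff]

theorem rename_injective {f : ℕ → ℕ} (hf : f.Injective) : (rename f).Injective := by
  intro t
  induction t generalizing f with
  | var i => intro u h; cases u <;> simp_all [rename, hf.eq_iff]
  | app t₁ t₂ h₁ h₂ =>
    intro u h
    cases u with
    | app u₁ u₂ =>
      simp only [rename, app.injEq] at h
      rw [h₁ hf h.1, h₂ hf h.2]
    | _ => simp [rename] at h
  | lam t ih =>
    intro u h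
    cases u with
    | lam u =>
      simp only [rename, lam.injEq] at h
      rw [ih (liftRen_injective hf) h]
    | _ => simp [rename] at h

theorem shift_shift (m n : ℕ) (t : DBTerm) : shift n (shift m t) = shift (m + n) t := by
  simp only [shift, rename_rename]
  congr 1
  funext i
  exact Nat.add_assoc i m n

theorem shift_zero (t : DBTerm) : shift 0 t = t := by
  rw [shift, rename_eq_subst]
  exact subst_var t

/-- A de Bruijn term as a suspension term. -/
def toSTerm (C : Type u) : DBTerm → STerm C
  | var i => .idx (i + 1)
  | app t₁ t₂ => .app (t₁.toSTerm C) (t₂.toSTerm C)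
  | lam t => .lam (t.toSTerm C)

theorem wf_toSTerm {C : Type u} (t : DBTerm) : (t.toSTerm C).WF := by
  induction t with
  | var i => simp [toSTerm, STerm.WF]
  | app t₁ t₂ h₁ h₂ => exact ⟨h₁, h₂⟩
  | lam t h => exact h

end DBTerm

/-! Congruence of the closure of the rewriting relation -/

section Congruence

variable {C : Type u}

theorem STerm.RMSteps.app {t₁ t₁' t₂ t₂' : STerm C} (h₁ : t₁.RMSteps t₁') (h₂ : t₂.RMSteps t₂') :
    (STerm.app t₁ t₂).RMSteps (.app t₁' t₂') :=
  (Relation.ReflTransGen.lift (STerm.app · t₂)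
      (fun _ _ h => STerm.RMStep.app_left _ h) _ _ h₁).trans
    (Relation.ReflTransGen.lift (STerm.app t₁' ·) (fun _ _ h => STerm.RMStep.app_right _ h) _ _ h₂)

theorem STerm.RMSteps.lam {t t' : STerm C} (h : t.RMSteps t') : (STerm.lam t).RMSteps (.lam t') :=
  Relation.ReflTransGen.lift STerm.lam (fun _ _ h => STerm.RMStep.lam h) _ _ h

theorem STerm.RMSteps.susp {t t' : STerm C} {e e' : SEnv C} (ol nl : ℕ) (ht : t.RMSteps t')
    (he : e.RMSteps e') : (STerm.susp t ol nl e).RMSteps (.susp t' ol nl e') :=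
  (Relation.ReflTransGen.lift (STerm.susp · ol nl e)
      (fun _ _ h => STerm.RMStep.susp_term _ _ _ h) _ _ ht).trans
    (Relation.ReflTransGen.lift (STerm.susp t' ol nl ·)
      (fun _ _ h => STerm.RMStep.susp_env _ _ _ h) _ _ he)

theorem SEnv.RMSteps.cons {t t' : STerm C} {e e' : SEnv C} (l : ℕ) (ht : t.RMSteps t')
    (he : e.RMSteps e') : (SEnv.cons t l e).RMSteps (.cons t' l e') :=
  (Relation.ReflTransGen.lift (SEnv.cons · l e)
      (fun _ _ h => SEnv.RMStep.cons_head _ _ h) _ _ ht).trans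
    (Relation.ReflTransGen.lift (SEnv.cons t' l ·)
      (fun _ _ h => SEnv.RMStep.cons_tail _ _ h) _ _ he)

theorem SEnv.RMSteps.merge {e₁ e₁' e₂ e₂' : SEnv C} (nl₁ ol₂ : ℕ) (h₁ : e₁.RMSteps e₁')
    (h₂ : e₂.RMSteps e₂') : (SEnv.merge e₁ nl₁ ol₂ e₂).RMSteps (.merge e₁' nl₁ ol₂ e₂') :=
  (Relation.ReflTransGen.lift (SEnv.merge · nl₁ ol₂ e₂)
      (fun _ _ h => SEnv.RMStep.merge_left _ _ _ h) _ _ h₁).trans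
    (Relation.ReflTransGen.lift (SEnv.merge e₁' nl₁ ol₂ ·)
      (fun _ _ h => SEnv.RMStep.merge_right _ _ _ h) _ _ h₂)

end Congruence

/-! Environments in normal form -/

/-- Lists of environment terms whose terms are pure. -/
abbrev DBEnv := List (DBTerm × ℕ)

namespace DBEnv

open DBTerm

/-- The levels are decreasing and bounded by `nl`. -/
def LevLE : DBEnv → ℕ → Prop
  | [], _ => True
  | p :: e, nl => p.2 ≤ nl ∧ LevLE e p.2

/-- The substitution denoted by an environment at the new embedding level `nl`. -/
def denote : DBEnv → ℕ → ℕ → DBTerm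
  | [], nl, i => .var (i + nl)
  | p :: _, nl, 0 => shift (nl - p.2) p.1
  | _ :: e, nl, i + 1 => denote e nl i

/-- The suspension environment given by a list. -/
def toSEnv (C : Type u) : DBEnv → SEnv C
  | [] => .nil
  | p :: e => .cons (p.1.toSTerm C) p.2 (toSEnv C e)

theorem LevLE.mono {e : DBEnv} {m n : ℕ} (h : LevLE e m) (hmn : m ≤ n) : LevLE e n := by
  cases e with
  | nil => trivial
  | cons p e => exact ⟨h.1.trans hmn, h.2⟩

theorem LevLE.tail {p : DBTerm × ℕ} {e : DBEnv} {n : ℕ} (h : LevLE (p :: e) n) : LevLE e n :=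
  h.2.mono h.1

theorem LevLE.lev_toSEnv {C : Type u} {e : DBEnv} {n : ℕ} (h : LevLE e n) :
    (toSEnv C e).lev ≤ n := by
  cases e with
  | nil => exact Nat.zero_le n
  | cons p e => exact h.1

/-- The bound on the levels matters: without it the truncated `m - p.2` would lose part of the
shift. -/
theorem denote_add {e : DBEnv} {m : ℕ} (h : LevLE e m) (n i : ℕ) :
    denote e (m + n) i = shift n (denote e m i) := by
  induction e generalizing i with
  | nil => simp only [denote, shift, rename, Nat.add_assoc]
  | cons p e ih =>
    cases i with
    | zero =>
      have := h.1
      simp only [denote, shift_shift]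
      congr 1
      omega
    | succ i => exact ih h.tail i

theorem denote_of_le {e : DBEnv} {m n : ℕ} (h : LevLE e m) (hmn : m ≤ n) (i : ℕ) :
    denote e n i = shift (n - m) (denote e m i) := by
  rw [← denote_add h, Nat.add_sub_cancel' hmn]

/-- This matches the environment created by (r6) with substitution under a binder. -/
theorem up_denote {e : DBEnv} {nl : ℕ} (h : LevLE e nl) :
    denote ((var 0, nl + 1) :: e) (nl + 1) = up (denote e nl) := by
  funext i
  cases i with
  | zero => simp [denote, shift_zero, up]
  | succ i => exact denote_add h 1 i

/-- Reading of a suspension over a pure term, provided that the environment terms can be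
renumbered. -/
theorem susp_rmSteps_aux {C : Type u} (t : DBTerm) {e : DBEnv} {nl : ℕ} (h : LevLE e nl)
    (he : ∀ p ∈ e, ∀ m, (STerm.susp (p.1.toSTerm C) 0 m .nil).RMSteps ((shift m p.1).toSTerm C)) :
    (STerm.susp (t.toSTerm C) e.length nl (toSEnv C e)).RMSteps
      ((t.subst (denote e nl)).toSTerm C) := by
  induction t generalizing e nl with
  | var i =>
    induction e generalizing i with
    | nil =>
      refine .single (.read ?_)
      have := STerm.ReadRule.r2 (C := C) (i + 1) nl
      rwa [Nat.add_right_comm] at this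
    | cons p e ih =>
      cases i with
      | zero => exact .head (.read (.r3 _ _ _ _ _)) (he p (by simp) _)
      | succ i =>
        exact .head (.read (.r4 _ _ _ _ _ _ (by omega)))
          (ih i h.tail fun q hq => he q (List.mem_cons_of_mem p hq))
  | app t₁ t₂ h₁ h₂ => exact .head (.read (.r5 _ _ _ _ _)) (STerm.RMSteps.app (h₁ h he) (h₂ h he))
  | lam t ih =>
    refine .head (.read (.r6 _ _ _ _)) (STerm.RMSteps.lam ?_)
    rw [← up_denote h]
    -- The entry added by (r6) is an index, so (r2) renumbers it at once and the assumption on the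
    -- environment survives.
    refine ih (e := (var 0, nl + 1) :: e) ⟨le_rfl, h.mono (Nat.le_succ nl)⟩ ?_
    intro p hp m
    rcases List.mem_cons.1 hp with rfl | hp
    · refine .single (.read ?_)
      have := STerm.ReadRule.r2 (C := C) (0 + 1) m
      rwa [Nat.add_right_comm] at this
    · exact he p hp m

/-- Rule (r3) leaves a suspension over the empty environment. That case comes first, because there
the renumbering assumption is vacuous; it then discharges the assumption in general. -/
theorem susp_nil_rmSteps {C : Type u} (t : DBTerm) (m : ℕ) :
    (STerm.susp (t.toSTerm C) 0 m .nil).RMSteps ((shift m t).toSTerm C) := by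
  rw [shift, rename_eq_subst]
  exact susp_rmSteps_aux t (e := []) trivial (by simp)

theorem susp_rmSteps {C : Type u} (t : DBTerm) {e : DBEnv} {nl : ℕ} (h : LevLE e nl) :
    (STerm.susp (t.toSTerm C) e.length nl (toSEnv C e)).RMSteps
      ((t.subst (denote e nl)).toSTerm C) :=
  susp_rmSteps_aux t h fun p _ m => susp_nil_rmSteps p.1 m

/-- A merged environment reduces to a list that denotes the composed substitution. -/
theorem exists_merge_rmSteps {C : Type u} (e₁ e₂ : DBEnv) (nl₁ nl₂ : ℕ) (h₁ : LevLE e₁ nl₁)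
    (h₂ : LevLE e₂ nl₂) :
    ∃ e : DBEnv,
      (SEnv.merge (toSEnv C e₁) nl₁ e₂.length (toSEnv C e₂)).RMSteps (toSEnv C e) ∧
      LevLE e (nl₂ + (nl₁ - e₂.length)) ∧ e.length = e₁.length + (e₂.length - nl₁) ∧
      ∀ i, denote e (nl₂ + (nl₁ - e₂.length)) i = (denote e₁ nl₁ i).subst (denote e₂ nl₂) := by
  -- The rules (m4) and (m5) consume the head of `e₂`, while (m6) consumes that of `e₁` and keeps
  -- `e₂`; hence an inner induction on `e₂` for each `e₁`.
  induction e₁ generalizing e₂ nl₁ nl₂ with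
  | nil =>
    induction e₂ generalizing nl₁ with
    | nil => exact ⟨[], .single (.merge (.m2 _ _)), trivial, by simp, fun i => by
        simp only [denote, subst, List.length_nil]
        congr 1
        omega⟩
    | cons q e₂ ih =>
      cases nl₁ with
      | zero => exact ⟨q :: e₂, .single (.merge (.m3 _ _)), by simpa using h₂, by simp, fun i => by
          simp [denote, subst]⟩
      | succ k =>
        obtain ⟨e, hr, hl, hn, hd⟩ := ih k trivial h₂.tail
        have e1 : k + 1 - (q :: e₂).length = k - e₂.length := by simp
        rw [e1]
        refine ⟨e, .head (.merge (.m4 _ _ _ _ _ (by omega))) hr, hl, by simpa using hn, ?_⟩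
        intro i
        rw [hd]
        rfl
  | cons p e₁ ih₁ =>
    induction e₂ generalizing nl₁ with
    | nil => exact ⟨p :: e₁, .single (.merge (.m2 _ _)), h₁.mono (by simp), by simp, fun i => by
        rw [List.length_nil, Nat.sub_zero, Nat.add_comm, denote_add h₁, shift, rename_eq_subst]
        rfl⟩
    | cons q e₂ ih =>
      rcases h₁.1.lt_or_eq with hlt | rfl
      · obtain ⟨k, rfl⟩ : ∃ k, nl₁ = k + 1 := ⟨nl₁ - 1, by omega⟩
        have h₁' : LevLE (p :: e₁) k := ⟨Nat.le_of_lt_succ hlt, h₁.2⟩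
        obtain ⟨e, hr, hl, hn, hd⟩ := ih k h₁' h₂.tail
        have e1 : k + 1 - (q :: e₂).length = k - e₂.length := by simp
        rw [e1]
        refine ⟨e, .head (.merge (.m5 _ _ _ _ _ _ _ _ hlt)) hr, hl, by simpa using hn, ?_⟩
        intro i
        rw [hd, denote_add h₁', shift, subst_rename]
        rfl
      -- Rule (m6) suspends the head at the level of the first entry of the second environment, not
      -- at `nl₂`, so the recursion runs at `q.2`.
      · have h₂' : LevLE (q :: e₂) q.2 := ⟨le_rfl, h₂.2⟩
        obtain ⟨e, hr, hl, hn, hd⟩ := ih₁ (q :: e₂) p.2 q.2 h₁.2 h₂'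
        generalize hk : p.2 - (q :: e₂).length = k at hl hd ⊢
        refine ⟨(p.1.subst (denote (q :: e₂) q.2), q.2 + k) :: e,
          .head (.merge (.m6 _ _ _ _ _ _ _)) ?_, ⟨Nat.add_le_add_right h₂.1 k, hl⟩, ?_, ?_⟩
        · have := SEnv.RMSteps.cons (q.2 + k) (susp_rmSteps (C := C) p.1 h₂') hr
          rw [← hk] at this ⊢
          exact this
        · simp only [List.length_cons] at hn ⊢
          omega
        -- Passing from `q.2` to `nl₂` is a uniform shift, which can be pulled out of the
        -- substitution.
        · have hs : denote (q :: e₂) nl₂ =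
              fun i => shift (nl₂ - q.2) (denote (q :: e₂) q.2 i) :=
            funext (denote_of_le h₂' h₂.1)
          intro i
          rw [hs, ← rename_subst]
          cases i with
          | zero =>
            simp only [denote, Nat.sub_self, shift_zero, Nat.add_sub_add_right]
          | succ i =>
            have := denote_of_le hl (Nat.add_le_add_right h₂.1 k) i
            rw [hd, Nat.add_sub_add_right] at this
            exact this

/-- Lists that denote the same substitution are similar after expansion. -/
theorem exists_sim {C : Type u} (e e' : DBEnv) (nl : ℕ) (hlen : e.length = e'.length)
    (h : LevLE e nl) (h' : LevLE e' nl) (hd : ∀ i, denote e nl i = denote e' nl i) :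
    ∃ d d' : SEnv C, d.WF ∧ d'.WF ∧ d.Sim d' ∧ d.RMSteps (toSEnv C e) ∧
      d'.RMSteps (toSEnv C e') ∧ d.lev = (toSEnv C e).lev ∧ d'.lev = (toSEnv C e').lev := by
  induction e generalizing e' with
  | nil =>
    obtain rfl := List.length_eq_zero_iff.1 hlen.symm
    exact ⟨.nil, .nil, trivial, trivial, .refl _, .refl, .refl, rfl, rfl⟩
  | cons p e ih =>
    cases e' with
    | nil => simp at hlen
    | cons p' e' =>
      obtain ⟨d, d', w, w', hs, hr, hr', hl, hl'⟩ :=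
        ih e' (by simpa using hlen) h.tail h'.tail fun i => hd (i + 1)
      -- The level equations are carried through the induction for this: they make the extended
      -- environments well formed.
      have hlev : d.lev ≤ p.2 := hl ▸ h.2.lev_toSEnv
      have hlev' : d'.lev ≤ p'.2 := hl' ▸ h'.2.lev_toSEnv
      obtain ⟨u, n⟩ := p
      obtain ⟨u', n'⟩ := p'
      have h0 : shift (nl - n) u = shift (nl - n') u' := hd 0
      have hn := h.1
      have hn' := h'.1
      simp only at hn hn' hlev hlev'
      have key (v : DBTerm) (m k : ℕ) (f : SEnv C) (wf : f.WF) (hf : f.lev ≤ m + k) :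
          (SEnv.cons (.susp (v.toSTerm C) 0 m .nil) (m + k) f).WF :=
        ⟨⟨wf_toSTerm v, trivial, rfl, Nat.zero_le m⟩, wf, hf⟩
      have inj (a : ℕ) := rename_injective (add_left_injective a)
      rcases le_total n n' with hle | hle
      · obtain ⟨k, rfl⟩ := Nat.exists_eq_add_of_le' hle
        -- Cancel the shift by `nl - (k + n)` common to both sides of `h0`.
        have hu : u' = shift k u := by
          refine (inj (nl - (k + n)) ?_).symm
          refine Eq.trans ?_ h0
          rw [← shift, shift_shift]
          congr 1
          omega
        subst hu
        -- Both heads are expanded to suspensions of the same `u`, renumbered by `0` and by `k`,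
        -- with levels `0 + n` and `k + n`, as `renumber` demands.
        refine ⟨_, _, key u 0 n d w (by simpa using hlev), key u k n d' w' hlev',
          .renumber 0 0 k n (.refl _) (.refl _) hs, ?_, .cons _ (susp_nil_rmSteps u k) hr',
          Nat.zero_add n, rfl⟩
        have := SEnv.RMSteps.cons (0 + n) (susp_nil_rmSteps u 0) hr
        rw [shift_zero] at this
        nth_rewrite 2 [Nat.zero_add] at this
        exact this
      · obtain ⟨k, rfl⟩ := Nat.exists_eq_add_of_le' hle
        have hu : u = shift k u' := by
          refine (inj (nl - (k + n')) ?_)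
          refine Eq.trans h0 ?_
          rw [← shift, shift_shift]
          congr 1
          omega
        subst hu
        refine ⟨_, _, key u' k n' d w hlev, key u' 0 n' d' w' (by simpa using hlev'),
          .renumber 0 k 0 n' (.refl _) (.refl _) hs, .cons _ (susp_nil_rmSteps u' k) hr, ?_,
          rfl, Nat.zero_add n'⟩
        have := SEnv.RMSteps.cons (0 + n') (susp_nil_rmSteps u' 0) hr'
        rw [shift_zero] at this
        nth_rewrite 2 [Nat.zero_add] at this
        exact this

end DBEnv

/-! Denotations of λσ-expressions -/

mutual
/-- The pure term denoted by a λσ-term. -/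
def LSTerm.denote : LSTerm → DBTerm
  | .one => .var 0
  | .app a b => .app a.denote b.denote
  | .lam a => .lam a.denote
  | .clos a s => a.denote.subst s.denote

/-- The function on indices denoted by a λσ-substitution. -/
def LSSub.denote : LSSub → ℕ → DBTerm
  | .id => .var
  | .shift => fun i => .var (i + 1)
  | .cons a s => fun i => Nat.casesOn i a.denote s.denote
  | .comp s t => fun i => (s.denote i).subst t.denote
end

theorem LSTerm.SigmaRule.denote_eq {a b : LSTerm} (h : a.SigmaRule b) : a.denote = b.denote := by
  cases h with
  | app a b s => rfl
  -- The substitution `1 · (s ∘ ↑)` denotes `up` of the denotation of `s`.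
  | abs a s =>
    simp only [LSTerm.denote, DBTerm.subst]
    congr 2
    funext i
    cases i with
    | zero => rfl
    | succ i => exact DBTerm.rename_eq_subst _ _
  | clos a s t => exact DBTerm.subst_subst _ _ _
  | varId => rfl
  | varCons a s => rfl

theorem LSSub.SigmaRule.denote_eq {s s' : LSSub} (h : s.SigmaRule s') : s.denote = s'.denote := by
  cases h with
  | map a s t => funext i; cases i <;> rfl
  | ass s t u => funext i; exact DBTerm.subst_subst _ _ _
  | idL s => rfl
  | shiftId => rfl
  | shiftCons a s => rfl

mutual
theorem LSTerm.SigmaStep.denote_eq {a b : LSTerm} : a.SigmaStep b → a.denote = b.denote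
  | .rule h => h.denote_eq
  | .app_left _ h => by simp only [LSTerm.denote, h.denote_eq]
  | .app_right _ h => by simp only [LSTerm.denote, h.denote_eq]
  | .lam h => by simp only [LSTerm.denote, h.denote_eq]
  | .clos_term _ h => by simp only [LSTerm.denote, h.denote_eq]
  | .clos_sub _ h => by simp only [LSTerm.denote, h.denote_eq]

theorem LSSub.SigmaStep.denote_eq {s s' : LSSub} : s.SigmaStep s' → s.denote = s'.denote
  | .rule h => h.denote_eq
  | .cons_head _ h => by simp only [LSSub.denote, h.denote_eq]
  | .cons_tail _ h => by simp only [LSSub.denote, h.denote_eq]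
  | .comp_left _ h => by simp only [LSSub.denote, h.denote_eq]
  | .comp_right _ h => by simp only [LSSub.denote, h.denote_eq]
end

/-! The embedding levels of translated substitutions -/

section Levels

variable (C : Type u)

/-- As `E(↑) = (0, 1, nil)`, the special clause for `s ∘ ↑` gives the same numbers as the general
one; only the environment differs. -/
theorem LSSub.toEnv_comp_ol (s t : LSSub) :
    ((s.comp t).toEnv C).1 = (s.toEnv C).1 + ((t.toEnv C).1 - (s.toEnv C).2.1) := by
  cases t <;> simp [LSSub.toEnv]

theorem LSSub.toEnv_comp_nl (s t : LSSub) :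
    ((s.comp t).toEnv C).2.1 = (t.toEnv C).2.1 + ((s.toEnv C).2.1 - (t.toEnv C).1) := by
  cases t <;> simp [LSSub.toEnv, Nat.add_comm]

theorem LSSub.SigmaRule.levels_eq {s s' : LSSub} (h : s.SigmaRule s') :
    (s.toEnv C).1 = (s'.toEnv C).1 ∧ (s.toEnv C).2.1 = (s'.toEnv C).2.1 := by
  cases h <;> simp only [LSSub.toEnv_comp_ol, LSSub.toEnv_comp_nl, LSSub.toEnv] <;>
    constructor <;> first | trivial | omega

theorem LSSub.SigmaStep.levels_eq {s s' : LSSub} :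
    s.SigmaStep s' → (s.toEnv C).1 = (s'.toEnv C).1 ∧ (s.toEnv C).2.1 = (s'.toEnv C).2.1
  | .rule h => h.levels_eq C
  | .cons_head _ _ => by simp only [LSSub.toEnv, and_self]
  | .cons_tail _ h => by simp only [LSSub.toEnv, h.levels_eq, and_self]
  | .comp_left _ h => by
    simp only [LSSub.toEnv_comp_ol, LSSub.toEnv_comp_nl, h.levels_eq, and_self]
  | .comp_right _ h => by
    simp only [LSSub.toEnv_comp_ol, LSSub.toEnv_comp_nl, h.levels_eq, and_self]

end Levels

/-! Normalization of translated expressions -/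

theorem LSSub.denote_of_shiftExp? :
    ∀ {s : LSSub} {n : ℕ}, s.shiftExp? = some n → ∀ i, s.denote i = .var (i + n)
  | .shift, n, h, i => by
    simp only [LSSub.shiftExp?, Option.some.injEq] at h
    subst h
    rfl
  | .comp s .shift, n, h, i => by
    simp only [LSSub.shiftExp?, Option.map_eq_some_iff] at h
    obtain ⟨m, hm, rfl⟩ := h
    simp only [LSSub.denote, LSSub.denote_of_shiftExp? hm, DBTerm.subst]
    rfl

mutual
theorem LSTerm.toSusp_rmSteps (C : Type u) : ∀ a : LSTerm,
    (a.toSusp C).RMSteps (a.denote.toSTerm C)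
  | .one => .refl
  | .app a b => .app (a.toSusp_rmSteps C) (b.toSusp_rmSteps C)
  | .lam a => .lam (a.toSusp_rmSteps C)
  | .clos a s => by
    have hsusp : (STerm.susp (a.toSusp C) (s.toEnv C).1 (s.toEnv C).2.1 (s.toEnv C).2.2).RMSteps
        ((LSTerm.clos a s).denote.toSTerm C) := by
      obtain ⟨e, hr, hl, hn, hd⟩ := s.toEnv_rmSteps C
      refine (STerm.RMSteps.susp _ _ (a.toSusp_rmSteps C) hr).trans ?_
      rw [← hn, LSTerm.denote, ← funext hd]
      exact DBEnv.susp_rmSteps a.denote hl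
    -- Only for `a = 1` can the clause `T(1[↑ⁿ]) = #(n+1)` intervene; its value is already the
    -- denoted index.
    cases a with
    | one =>
      cases hs : s.shiftExp? with
      | none => simpa only [LSTerm.toSusp, hs] using hsusp
      | some n =>
        simp only [LSTerm.toSusp, hs, LSTerm.denote, DBTerm.subst, LSSub.denote_of_shiftExp? hs,
          DBTerm.toSTerm, Nat.zero_add]
        exact .refl
    | _ => simpa only [LSTerm.toSusp] using hsusp

theorem LSSub.toEnv_rmSteps (C : Type u) : ∀ s : LSSub, ∃ e : DBEnv,
    (s.toEnv C).2.2.RMSteps (e.toSEnv C) ∧ e.LevLE (s.toEnv C).2.1 ∧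
      e.length = (s.toEnv C).1 ∧ ∀ i, e.denote (s.toEnv C).2.1 i = s.denote i
  | .id => ⟨[], .refl, trivial, rfl, fun _ => rfl⟩
  | .shift => ⟨[], .refl, trivial, rfl, fun _ => rfl⟩
  | .cons a s => by
    obtain ⟨e, hr, hl, hn, hd⟩ := s.toEnv_rmSteps C
    refine ⟨(a.denote, (s.toEnv C).2.1) :: e, .cons _ (a.toSusp_rmSteps C) hr, ⟨le_rfl, hl⟩,
      congrArg (· + 1) hn, ?_⟩
    rintro (_ | i)
    · simp only [LSSub.toEnv, DBEnv.denote, Nat.sub_self, DBTerm.shift_zero]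
      rfl
    · exact hd i
  | .comp s t => by
    obtain ⟨e₁, hr₁, hl₁, hn₁, hd₁⟩ := s.toEnv_rmSteps C
    obtain ⟨e₂, hr₂, hl₂, hn₂, hd₂⟩ := t.toEnv_rmSteps C
    obtain ⟨e, hr, hl, hn, hd⟩ := DBEnv.exists_merge_rmSteps (C := C) e₁ e₂ _ _ hl₁ hl₂
    rw [hn₂] at hl hd hr hn
    rw [hn₁] at hn
    have hr' := (SEnv.RMSteps.merge (s.toEnv C).2.1 (t.toEnv C).1 hr₁ hr₂).trans hr
    rw [LSSub.toEnv_comp_ol, LSSub.toEnv_comp_nl]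
    have hd' : ∀ i, e.denote ((t.toEnv C).2.1 + ((s.toEnv C).2.1 - (t.toEnv C).1)) i =
        (s.comp t).denote i := fun i => by rw [hd, hd₁, funext hd₂, LSSub.denote]
    -- For `s ∘ ↑` the translation keeps the environment of `s` without a merge; raising the level
    -- by one performs the shift.
    cases t with
    | shift =>
      refine ⟨e₁, hr₁, hl₁.mono (by simp [LSSub.toEnv]), by simpa [LSSub.toEnv] using hn₁, ?_⟩
      intro i
      simp only [LSSub.toEnv, Nat.sub_zero]
      rw [Nat.add_comm, DBEnv.denote_add hl₁, hd₁, DBTerm.shift, DBTerm.rename_eq_subst]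
      rfl
    | _ => exact ⟨e, hr', hl, hn, hd'⟩
end

-- The simulation theorem.

theorem mainTheorem11 {C : Type u} :
    (∀ a b : LSTerm, a.SigmaStep b →
      ∃ t : STerm C, t.WF ∧ (a.toSusp C).RMSteps t ∧ (b.toSusp C).RMSteps t) ∧
    (∀ s s' : LSSub, s.SigmaStep s' →
      ∀ (ol nl ol' nl' : ℕ) (e e' : SEnv C),
        s.toEnv C = (ol, nl, e) → s'.toEnv C = (ol', nl', e') →
        ol = ol' ∧ nl = nl' ∧
        ∃ d d' : SEnv C, d.WF ∧ d'.WF ∧ d.Sim d' ∧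
          (∃ f : SEnv C, e.RMSteps f ∧ d.RMSteps f) ∧
          (∃ f' : SEnv C, e'.RMSteps f' ∧ d'.RMSteps f')) := by
  refine ⟨fun a b h => ⟨a.denote.toSTerm C, DBTerm.wf_toSTerm _, a.toSusp_rmSteps C, ?_⟩, ?_⟩
  · rw [h.denote_eq]
    exact b.toSusp_rmSteps C
  · intro s s' h ol nl ol' nl' e e' hs hs'
    obtain ⟨hol, hnl⟩ := h.levels_eq C
    obtain ⟨f, hr, hl, hn, hd⟩ := s.toEnv_rmSteps C
    obtain ⟨f', hr', hl', hn', hd'⟩ := s'.toEnv_rmSteps C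
    simp only [hs, hs'] at hol hnl hr hl hn hd hr' hl' hn' hd'
    subst hol hnl
    obtain ⟨d, d', w, w', hsim, hdr, hdr', -, -⟩ := DBEnv.exists_sim (C := C) f f' nl
      (hn.trans hn'.symm) hl hl' fun i => by rw [hd, hd', h.denote_eq]
    exact ⟨rfl, rfl, d, d', w, w', hsim, ⟨_, hr, hdr⟩, ⟨_, hr', hdr'⟩⟩
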